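/- **Theorem (Exponentiability of strict coalgebras).** Let $\mathcal{S}=(\mathcal{S},\varepsilon,\delta)$ be a 2-comonad on a 2-category $\mathfrak{B}$, that is, a strict 2-functor $\mathcal{S}:\mathfrak{B}\to\mathfrak{B}$ with 2-natural transformations $\varepsilon:\mathcal{S}\Rightarrow \mathrm{Id}$ and $\delta:\mathcal{S}\Rightarrow\mathcal{S}\mathcal{S}$ satisfying the comonad laws strictly. Suppose that $\mathfrak{B}$ has binary products and equalizers of parallel pairs of 1-cells, both in the 2-categorical ($\mathrm{Cat}$-enriched) sense, that is, with universal properties expressed by isomorphisms of hom-categories, and that $\mathcal{S}$ preserves them. (This covers the case where $\mathfrak{B}$ has and $\mathcal{S}$ preserves all finite, or all small, products.) Let $\mathcal{S}\text{-}\mathrm{CoAlg}_{\mathrm{s}}$ be the 2-category of strict $\mathcal{S}$-coalgebras, strict morphisms of coalgebras and 2-cells $\alpha$ of $\mathfrak{B}$ compatible with the coalgebra structures $a_x$, i.e. $\mathcal{S}(\alpha)\, a_x = a_y\,\alpha$ (whiskered) for $\alpha: f\Rightarrow g : x\to y$. Then the forgetful 2-functor $L:\mathcal{S}\text{-}\mathrm{CoAlg}_{\mathrm{s}}\to\mathfrak{B}$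 reflects exponentiable objects: for every strict coalgebra $\mathtt{y}$, if $L(\mathtt{y})$ is exponentiable in $\mathfrak{B}$, then $\mathtt{y}$ is exponentiable in $\mathcal{S}\text{-}\mathrm{CoAlg}_{\mathrm{s}}$. Here an object $Y$ of a 2-category $\mathfrak{C}$ is *exponentiable* if the 2-categorical products $Y\times X$ exist for all objects $X$ of $\mathfrak{C}$ and the resulting 2-functor $Y\times - : \mathfrak{C}\to\mathfrak{C}$ has a right 2-adjoint. -/

import Mathlib

open CategoryTheory Bicategory

universe w v u w₁ v₁ u₁ w₂ v₂ u₂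

noncomputable section

namespace TwoCat

/-! Throughout, a 2-category is a strict bicategory (`[Bicategory B] [Bicategory.Strict B]`) and a
2-functor is a `StrictPseudofunctor`. Equalities between 2-cells whose source and target 1-cells
agree only propositionally are expressed through `eqToHom`. -/

section Whisker

variable {B : Type u} [Bicategory.{w, v} B] [Strict B]

theorem whiskerLeft_whiskerLeft {a b c d : B} {f : a ⟶ b} {g : b ⟶ c} {k : a ⟶ c}
    (h : f ≫ g = k) {p q : c ⟶ d} (η : p ⟶ q) :
    f ◁ g ◁ η = eqToHom (by rw [← h, Strict.assoc]) ≫ k ◁ η ≫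
      eqToHom (by rw [← h, Strict.assoc]) := by
  subst h
  simp [Strict.associator_eqToIso]

theorem whiskerRight_whiskerRight {a b c d : B} {p q : a ⟶ b} (η : p ⟶ q) {g : b ⟶ c}
    {h : c ⟶ d} {k : b ⟶ d} (e : g ≫ h = k) :
    η ▷ g ▷ h = eqToHom (by rw [← e, Strict.assoc]) ≫ η ▷ k ≫
      eqToHom (by rw [← e, Strict.assoc]) := by
  subst e
  simp [Strict.associator_eqToIso]

end Whisker

section TwoNatTrans

variable {B : Type u₁} [Bicategory.{w₁, v₁} B] {C : Type u₂} [Bicategory.{w₂, v₂} C]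

/-- A (strict) 2-natural transformation between 2-functors. -/
structure TwoNatTrans (F G : StrictPseudofunctor B C) where
  /-- The 1-cell components. -/
  app (a : B) : F.obj a ⟶ G.obj a
  /-- Naturality with respect to 1-cells, as a strict equality. -/
  naturality {a b : B} (f : a ⟶ b) : F.map f ≫ app b = app a ≫ G.map f
  /-- Naturality with respect to 2-cells. -/
  naturality₂ {a b : B} {f g : a ⟶ b} (η : f ⟶ g) :
    F.map₂ η ▷ app b ≫ eqToHom (naturality g) = eqToHom (naturality f) ≫ app a ◁ G.map₂ η

/-- A 2-adjunction `F ⊣ G`, given by 2-natural unit and counit which satisfy the triangle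
identities strictly. -/
structure TwoAdjunction (F : StrictPseudofunctor B C) (G : StrictPseudofunctor C B) where
  /-- The unit. -/
  unit : TwoNatTrans (StrictPseudofunctor.id B) (F.comp G)
  /-- The counit. -/
  counit : TwoNatTrans (G.comp F) (StrictPseudofunctor.id C)
  left_triangle (a : B) : F.map (unit.app a) ≫ counit.app (F.obj a) = 𝟙 (F.obj a)
  right_triangle (c : C) : unit.app (G.obj c) ≫ G.map (counit.app c) = 𝟙 (G.obj c)

/-- A 2-functor has a right 2-adjoint. -/
def HasRightTwoAdjoint (F : StrictPseudofunctor B C) : Prop :=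
  ∃ G : StrictPseudofunctor C B, Nonempty (TwoAdjunction F G)

end TwoNatTrans

section Limits

variable {B : Type u} [Bicategory.{w, v} B]

/-- `X ←p- P -q→ Y` is a 2-categorical product: for every `W`, the functor
`B(W, P) ⥤ B(W, X) × B(W, Y)` induced by `p` and `q` is an isomorphism of categories, that is,
bijective on objects and fully faithful. -/
structure IsTwoProduct {P X Y : B} (p : P ⟶ X) (q : P ⟶ Y) : Prop where
  exists_lift {W : B} (f : W ⟶ X) (g : W ⟶ Y) : ∃! l : W ⟶ P, l ≫ p = f ∧ l ≫ q = g
  exists_lift₂ {W : B} (l m : W ⟶ P) (α : l ≫ p ⟶ m ≫ p) (β : l ≫ q ⟶ m ≫ q) :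
    ∃! γ : l ⟶ m, γ ▷ p = α ∧ γ ▷ q = β

variable (B) in
/-- Every pair of objects has a 2-categorical product. -/
def HasTwoProducts : Prop :=
  ∀ X Y : B, ∃ (P : B) (p : P ⟶ X) (q : P ⟶ Y), IsTwoProduct p q

theorem fork_comp [Strict B] {W E X Y : B} {f g : X ⟶ Y} {i : E ⟶ X} (h : i ≫ f = i ≫ g)
    (l : W ⟶ E) : (l ≫ i) ≫ f = (l ≫ i) ≫ g := by
  rw [Strict.assoc, h, ← Strict.assoc]

/-- `i : E ⟶ X` is a 2-categorical equalizer of `f, g : X ⟶ Y`: for every `W`, composition with `i`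
is an isomorphism (bijective on objects and fully faithful) from the category `B(W, E)` to the
equalizer in `Cat` of the two functors `B(W, X) ⥤ B(W, Y)` induced by `f` and `g`. -/
structure IsTwoEqualizer [Strict B] {E X Y : B} (f g : X ⟶ Y) (i : E ⟶ X) : Prop where
  condition : i ≫ f = i ≫ g
  exists_lift {W : B} (h : W ⟶ X) (hh : h ≫ f = h ≫ g) : ∃! l : W ⟶ E, l ≫ i = h
  exists_lift₂ {W : B} (l m : W ⟶ E) (β : l ≫ i ⟶ m ≫ i)
    (hβ : β ▷ f ≫ eqToHom (fork_comp condition m) = eqToHom (fork_comp condition l) ≫ β ▷ g) :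
    ∃! γ : l ⟶ m, γ ▷ i = β

variable (B) in
/-- Every parallel pair of 1-cells has a 2-categorical equalizer. -/
def HasTwoEqualizers [Strict B] : Prop :=
  ∀ (X Y : B) (f g : X ⟶ Y), ∃ (E : B) (i : E ⟶ X), IsTwoEqualizer f g i

variable {C : Type u₂} [Bicategory.{w₂, v₂} C]

/-- The 2-functor `F` sends 2-categorical products to 2-categorical products. -/
def PreservesTwoProducts (F : StrictPseudofunctor B C) : Prop :=
  ∀ ⦃P X Y : B⦄ (p : P ⟶ X) (q : P ⟶ Y), IsTwoProduct p q → IsTwoProduct (F.map p) (F.map q)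

/-- The 2-functor `F` sends 2-categorical equalizers to 2-categorical equalizers. -/
def PreservesTwoEqualizers [Strict B] [Strict C] (F : StrictPseudofunctor B C) : Prop :=
  ∀ ⦃E X Y : B⦄ (f g : X ⟶ Y) (i : E ⟶ X),
    IsTwoEqualizer f g i → IsTwoEqualizer (F.map f) (F.map g) (F.map i)

end Limits

section Exponentiable

variable {B : Type u} [Bicategory.{w, v} B]

/-- A choice of a 2-categorical product `Y × X` for every object `X`. -/
structure ProductsWith (Y : B) where
  /-- The object `Y × X`. -/
  prod (X : B) : B
  /-- The projection to `Y`. -/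
  fst (X : B) : prod X ⟶ Y
  /-- The projection to `X`. -/
  snd (X : B) : prod X ⟶ X
  isTwoProduct (X : B) : IsTwoProduct (fst X) (snd X)

namespace ProductsWith

variable {Y : B} (c : ProductsWith Y)

/-- The 1-cell `Y × f`. -/
def map {X X' : B} (f : X ⟶ X') : c.prod X ⟶ c.prod X' :=
  ((c.isTwoProduct X').exists_lift (c.fst X) (c.snd X ≫ f)).choose

theorem map_fst {X X' : B} (f : X ⟶ X') : c.map f ≫ c.fst X' = c.fst X :=
  ((c.isTwoProduct X').exists_lift (c.fst X) (c.snd X ≫ f)).choose_spec.1.1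

theorem map_snd {X X' : B} (f : X ⟶ X') : c.map f ≫ c.snd X' = c.snd X ≫ f :=
  ((c.isTwoProduct X').exists_lift (c.fst X) (c.snd X ≫ f)).choose_spec.1.2

theorem hom_ext {W X : B} {l m : W ⟶ c.prod X} (h₁ : l ≫ c.fst X = m ≫ c.fst X)
    (h₂ : l ≫ c.snd X = m ≫ c.snd X) : l = m :=
  ((c.isTwoProduct X).exists_lift (m ≫ c.fst X) (m ≫ c.snd X)).unique ⟨h₁, h₂⟩ ⟨rfl, rfl⟩

theorem hom₂_ext {W X : B} {l m : W ⟶ c.prod X} {γ δ : l ⟶ m} (h₁ : γ ▷ c.fst X = δ ▷ c.fst X)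
    (h₂ : γ ▷ c.snd X = δ ▷ c.snd X) : γ = δ :=
  ((c.isTwoProduct X).exists_lift₂ l m (δ ▷ c.fst X) (δ ▷ c.snd X)).unique ⟨h₁, h₂⟩ ⟨rfl, rfl⟩

/-- The 2-cell `Y × η`: its projection to `Y` is an identity and its projection to `X'` is
`snd ◁ η`. -/
def map₂ {X X' : B} {f g : X ⟶ X'} (η : f ⟶ g) : c.map f ⟶ c.map g :=
  ((c.isTwoProduct X').exists_lift₂ (c.map f) (c.map g)
    (eqToHom ((c.map_fst f).trans (c.map_fst g).symm))
    (eqToHom (c.map_snd f) ≫ c.snd X ◁ η ≫ eqToHom (c.map_snd g).symm)).choose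

theorem map₂_fst {X X' : B} {f g : X ⟶ X'} (η : f ⟶ g) :
    c.map₂ η ▷ c.fst X' = eqToHom ((c.map_fst f).trans (c.map_fst g).symm) :=
  ((c.isTwoProduct X').exists_lift₂ (c.map f) (c.map g)
    (eqToHom ((c.map_fst f).trans (c.map_fst g).symm))
    (eqToHom (c.map_snd f) ≫ c.snd X ◁ η ≫ eqToHom (c.map_snd g).symm)).choose_spec.1.1

theorem map₂_snd {X X' : B} {f g : X ⟶ X'} (η : f ⟶ g) :
    c.map₂ η ▷ c.snd X' =
      eqToHom (c.map_snd f) ≫ c.snd X ◁ η ≫ eqToHom (c.map_snd g).symm :=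
  ((c.isTwoProduct X').exists_lift₂ (c.map f) (c.map g)
    (eqToHom ((c.map_fst f).trans (c.map_fst g).symm))
    (eqToHom (c.map_snd f) ≫ c.snd X ◁ η ≫ eqToHom (c.map_snd g).symm)).choose_spec.1.2

variable [Strict B]

theorem map_id (X : B) : c.map (𝟙 X) = 𝟙 (c.prod X) := by
  apply c.hom_ext
  · rw [map_fst, Strict.id_comp]
  · rw [map_snd, Strict.id_comp, Strict.comp_id]

theorem map_comp {X X' X'' : B} (f : X ⟶ X') (g : X' ⟶ X'') :
    c.map (f ≫ g) = c.map f ≫ c.map g := by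
  apply c.hom_ext
  · rw [map_fst, Strict.assoc, map_fst, map_fst]
  · rw [map_snd, Strict.assoc, map_snd, ← Strict.assoc, ← Strict.assoc, map_snd]

attribute [local simp] Strict.leftUnitor_eqToIso Strict.rightUnitor_eqToIso
  Strict.associator_eqToIso

/-- The 2-functor `Y × - : B ⥤ B`. -/
def twoFunctor : StrictPseudofunctor B B :=
  StrictPseudofunctor.mk''
    { obj := c.prod
      map := c.map
      map₂ := c.map₂
      map₂_id := fun f => by
        apply c.hom₂_ext
        · simp [map₂_fst]
        · simp [map₂_snd]
      map₂_comp := fun η θ => by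
        apply c.hom₂_ext
        · simp [map₂_fst]
        · simp [map₂_snd]
      map_id := c.map_id
      map_comp := c.map_comp
      map₂_whisker_left := fun f g g' η => by
        apply c.hom₂_ext
        · simp [map₂_fst]
        · simp [map₂_snd, whiskerLeft_whiskerLeft (c.map_snd f)]
      map₂_whisker_right := fun η g => by
        apply c.hom₂_ext
        · simp [map₂_fst, whiskerRight_whiskerRight _ (c.map_fst g)]
        · simp [map₂_snd, whiskerRight_whiskerRight _ (c.map_snd g)] }

end ProductsWith

/-- `Y` is exponentiable: the 2-categorical products `Y × X` exist, and the 2-functor `Y × -` has a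
right 2-adjoint. -/
def Exponentiable [Strict B] (Y : B) : Prop :=
  ∃ c : ProductsWith Y, HasRightTwoAdjoint c.twoFunctor

end Exponentiable

/-- A 2-comonad on `B`. -/
structure TwoComonad (B : Type u) [Bicategory.{w, v} B] where
  /-- The underlying 2-functor. -/
  F : StrictPseudofunctor B B
  /-- The counit. -/
  counit : TwoNatTrans F (StrictPseudofunctor.id B)
  /-- The comultiplication. -/
  comul : TwoNatTrans F (F.comp F)
  counit_comul (a : B) : comul.app a ≫ counit.app (F.obj a) = 𝟙 (F.obj a)
  comul_counit (a : B) : comul.app a ≫ F.map (counit.app a) = 𝟙 (F.obj a)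
  coassoc (a : B) : comul.app a ≫ comul.app (F.obj a) = comul.app a ≫ F.map (comul.app a)

namespace TwoComonad

variable {B : Type u} [Bicategory.{w, v} B]

/-- A strict coalgebra of the 2-comonad `S`. -/
structure CoAlg (S : TwoComonad B) where
  /-- The underlying object. -/
  carrier : B
  /-- The structure 1-cell. -/
  str : carrier ⟶ S.F.obj carrier
  counit : str ≫ S.counit.app carrier = 𝟙 carrier
  coassoc : str ≫ S.comul.app carrier = str ≫ S.F.map str

namespace CoAlg

variable {S : TwoComonad B}

/-- A strict morphism of strict coalgebras. -/
@[ext]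
structure Hom (x y : CoAlg S) where
  /-- The underlying 1-cell. -/
  f : x.carrier ⟶ y.carrier
  comm : x.str ≫ S.F.map f = f ≫ y.str

/-- A 2-cell of strict coalgebras. -/
@[ext]
structure Hom₂ {x y : CoAlg S} (f g : Hom x y) where
  /-- The underlying 2-cell. -/
  α : f.f ⟶ g.f
  comm : x.str ◁ S.F.map₂ α ≫ eqToHom g.comm = eqToHom f.comm ≫ α ▷ y.str

theorem Hom₂.comm' {x y : CoAlg S} {f g : Hom x y} (η : Hom₂ f g) :
    x.str ◁ S.F.map₂ η.α = eqToHom f.comm ≫ η.α ▷ y.str ≫ eqToHom g.comm.symm := by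
  rw [← reassoc_of% η.comm]; simp

variable [Strict B]

instance : CategoryStruct (CoAlg S) where
  Hom := Hom
  id x := ⟨𝟙 _, by rw [S.F.map_id, Strict.id_comp, Strict.comp_id]⟩
  comp {x y z} f g := ⟨f.f ≫ g.f, by
    rw [S.F.map_comp, ← Strict.assoc, f.comm, Strict.assoc, g.comm, Strict.assoc]⟩

attribute [local simp] Strict.leftUnitor_eqToIso Strict.rightUnitor_eqToIso
  Strict.associator_eqToIso PrelaxFunctor.map₂_eqToHom StrictPseudofunctor.mapComp_eq_eqToIso

instance (x y : CoAlg S) : Category (x ⟶ y) where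
  Hom f g := Hom₂ f g
  id f := ⟨𝟙 _, by simp⟩
  comp η θ := ⟨η.α ≫ θ.α, by simp [θ.comm, reassoc_of% η.comm]⟩
  id_comp η := Hom₂.ext (Category.id_comp η.α)
  comp_id η := Hom₂.ext (Category.comp_id η.α)
  assoc η θ κ := Hom₂.ext (Category.assoc η.α θ.α κ.α)

@[ext]
theorem hom_ext {x y : CoAlg S} {f g : x ⟶ y} (h : f.f = g.f) : f = g := Hom.ext h

@[ext]
theorem hom₂_ext {x y : CoAlg S} {f g : x ⟶ y} {η θ : f ⟶ g} (h : η.α = θ.α) : η = θ :=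
  Hom₂.ext h

@[simp] theorem id_f (x : CoAlg S) : (𝟙 x : x ⟶ x).f = 𝟙 x.carrier := rfl

@[simp] theorem comp_f {x y z : CoAlg S} (f : x ⟶ y) (g : y ⟶ z) : (f ≫ g).f = f.f ≫ g.f := rfl

@[simp] theorem id_α {x y : CoAlg S} (f : x ⟶ y) : (𝟙 f : f ⟶ f).α = 𝟙 f.f := rfl

@[simp] theorem comp_α {x y : CoAlg S} {f g h : x ⟶ y} (η : f ⟶ g) (θ : g ⟶ h) :
    (η ≫ θ).α = η.α ≫ θ.α := rfl

@[simp] theorem eqToHom_α {x y : CoAlg S} {f g : x ⟶ y} (h : f = g) :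
    (eqToHom h : f ⟶ g).α = eqToHom (congrArg Hom.f h) := by
  subst h; rfl

/-- Whiskering on the left in the 2-category of strict coalgebras. -/
def wLeft {x y z : CoAlg S} (f : x ⟶ y) {g h : y ⟶ z} (η : g ⟶ h) : f ≫ g ⟶ f ≫ h where
  α := f.f ◁ η.α
  comm := by
    simp [S.F.map₂_whisker_left, whiskerLeft_whiskerLeft f.comm, η.comm']

/-- Whiskering on the right in the 2-category of strict coalgebras. -/
def wRight {x y z : CoAlg S} {f g : x ⟶ y} (η : f ⟶ g) (h : y ⟶ z) : f ≫ h ⟶ g ≫ h where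
  α := η.α ▷ h.f
  comm := by
    have := congrArg (fun t => t ▷ S.F.map h.f) (Hom₂.comm' η)
    simp only [comp_whiskerRight, whisker_assoc] at this
    simp [S.F.map₂_whisker_right, whiskerRight_whiskerRight _ h.comm] at this ⊢
    rw [eqToHom_comp_iff, comp_eqToHom_iff] at this
    simp [this]

/-- The 2-category `S-CoAlg_s` of strict coalgebras, strict morphisms and 2-cells. -/
instance : Bicategory (CoAlg S) where
  whiskerLeft f _ _ η := wLeft f η
  whiskerRight η h := wRight η h
  associator f g h := eqToIso (hom_ext (Strict.assoc f.f g.f h.f))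
  leftUnitor f := eqToIso (hom_ext (Strict.id_comp f.f))
  rightUnitor f := eqToIso (hom_ext (Strict.comp_id f.f))
  whiskerLeft_id _ _ := by ext; simp [wLeft]
  whiskerLeft_comp _ _ _ _ _ _ := by ext; simp [wLeft]
  id_whiskerLeft _ := by ext; simp [wLeft]
  comp_whiskerLeft _ _ _ _ _ := by ext; simp [wLeft]
  id_whiskerRight _ _ := by ext; simp [wRight]
  comp_whiskerRight _ _ _ := by ext; simp [wRight]
  whiskerRight_id _ := by ext; simp [wRight]
  whiskerRight_comp _ _ _ := by ext; simp [wRight]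
  whisker_assoc _ _ _ _ _ := by ext; simp [wLeft, wRight]
  whisker_exchange η θ := by ext; exact whisker_exchange η.α θ.α
  pentagon _ _ _ _ := by ext; simp [wLeft, wRight]
  triangle _ _ := by ext; simp [wLeft, wRight]

instance : Strict (CoAlg S) where
  id_comp f := hom_ext (Strict.id_comp f.f)
  comp_id f := hom_ext (Strict.comp_id f.f)
  assoc f g h := hom_ext (Strict.assoc f.f g.f h.f)
  leftUnitor_eqToIso _ := rfl
  rightUnitor_eqToIso _ := rfl
  associator_eqToIso _ _ _ := rfl

end CoAlg

/-- The forgetful 2-functor `S-CoAlg_s ⥤ B`. -/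
def forget [Strict B] (S : TwoComonad B) : StrictPseudofunctor (CoAlg S) B :=
  StrictPseudofunctor.mk''
    { obj := CoAlg.carrier
      map := fun f => f.f
      map₂ := fun η => η.α
      map₂_id := fun _ => rfl
      map₂_comp := fun _ _ => rfl
      map_id := fun _ => rfl
      map_comp := fun _ _ => rfl
      map₂_whisker_left := fun f _ _ η => by
        simp; rfl
      map₂_whisker_right := fun η g => by
        simp; rfl }

end TwoComonad

end TwoCat

end

open CategoryTheory Bicategory

noncomputable section

namespace TwoCat

/-! Under horizontal composition the 2-cells of a strict 2-category form an ordinary category `Cells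
B`, in which 1-cells sit as identity 2-cells. Isomorphisms of hom-categories become unique existence
statements about 2-cells there, covering both dimensions at once and removing the `eqToHom`
corrections. The argument can then be run as for ordinary categories.

Let `y` be a coalgebra on `Y`, and let `H` be right 2-adjoint to `Y × -` on `B`, with evaluation
`ev`. As `S` preserves products, the structure of `y` gives a natural strength `Y × S X ⟶ S (Y ×
X)`, which makes `Y × X` the product coalgebra `y × x` (`isTwoProduct_prod`). Given a coalgebra `z`
on `Z`, a map `Y × X ⟶ Z` with transpose `k : X ⟶ H Z` is a coalgebra morphism iff `k ≫ f = x.str ≫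
S k ≫ g`, where `f : H Z ⟶ H (S Z)` is the transpose of `ev ≫ z.str` and `g : S (H Z) ⟶ H (S Z)`
that of the strength followed by `S ev` (`cell_prodStr_comp_iff`). Such `k` are classified by an
equalizer of cofree coalgebras `S (H Z) ⇉ S (H (S Z))`, which exists because `S` preserves
equalizers (`exists_equalizer`). This equalizer is the exponential, and universal arrows assemble
into a right 2-adjoint (`HasRightTwoAdjoint.of_isTwoUniversal`). -/

/-- A 2-cell bundled with its source and target 1-cells. -/
structure Cell {B : Type u} [Bicategory.{w, v} B] (a b : B) where
  /-- The source 1-cell. -/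
  src : a ⟶ b
  /-- The target 1-cell. -/
  tgt : a ⟶ b
  /-- The 2-cell. -/
  hom : src ⟶ tgt

/-- The objects of `B`, seen as the objects of the category whose morphisms are the 2-cells of `B`
under horizontal composition. -/
structure Cells (B : Type u) where
  /-- The underlying object. -/
  as : B

/-! ### The category of 2-cells under horizontal composition. -/

section Cells

variable {B : Type u} [Bicategory.{w, v} B]

namespace Cell

theorem ext_eqToHom {a b : B} {x y : Cell a b} (hs : x.src = y.src) (ht : x.tgt = y.tgt)
    (h : x.hom ≫ eqToHom ht = eqToHom hs ≫ y.hom) : x = y := by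
  obtain ⟨f, g, η⟩ := x
  obtain ⟨f', g', θ⟩ := y
  obtain rfl : f = f' := hs
  obtain rfl : g = g' := ht
  simp only [eqToHom_refl, Category.comp_id, Category.id_comp] at h
  rw [h]

theorem hom_eq_of_eq {a b : B} {x y : Cell a b} (h : x = y) :
    x.hom ≫ eqToHom (congrArg tgt h) = eqToHom (congrArg src h) ≫ y.hom := by
  subst h
  simp

theorem mk_injective {a b : B} {f g : a ⟶ b} {η θ : f ⟶ g}
    (h : (⟨f, g, η⟩ : Cell a b) = ⟨f, g, θ⟩) : η = θ := by
  simpa using hom_eq_of_eq h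

end Cell

instance : CategoryStruct (Cells B) where
  Hom X Y := Cell X.as Y.as
  id X := ⟨𝟙 X.as, 𝟙 X.as, 𝟙 (𝟙 X.as)⟩
  comp x y := ⟨x.src ≫ y.src, x.tgt ≫ y.tgt, x.hom ▷ y.src ≫ x.tgt ◁ y.hom⟩

/-- A 2-cell as a morphism of `Cells B`. -/
def cell {a b : B} {f g : a ⟶ b} (η : f ⟶ g) : Cells.mk a ⟶ Cells.mk b := ⟨f, g, η⟩

/-- A 1-cell as a morphism of `Cells B`. -/
def cell₁ {a b : B} (f : a ⟶ b) : Cells.mk a ⟶ Cells.mk b := cell (𝟙 f)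

theorem cell_injective {a b : B} {f g : a ⟶ b} {η θ : f ⟶ g} (h : cell η = cell θ) : η = θ :=
  Cell.mk_injective h

theorem cell₁_injective {a b : B} {f g : a ⟶ b} (h : cell₁ f = cell₁ g) : f = g :=
  congrArg Cell.src h

/-- With its converse `comp_eqToHom_eq_of_cell_eq`, this translates equations corrected by `eqToHom`
into plain equations of bundled 2-cells. -/
theorem cell_eq {a b : B} {f g f' g' : a ⟶ b} {η : f ⟶ g} {θ : f' ⟶ g'} (hf : f = f')
    (hg : g = g') (h : η ≫ eqToHom hg = eqToHom hf ≫ θ) : cell η = cell θ :=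
  Cell.ext_eqToHom hf hg h

theorem comp_eqToHom_eq_of_cell_eq {a b : B} {f g f' g' : a ⟶ b} {η : f ⟶ g} {θ : f' ⟶ g'}
    (hf : f = f') (hg : g = g') (h : cell η = cell θ) : η ≫ eqToHom hg = eqToHom hf ≫ θ :=
  Cell.hom_eq_of_eq h

theorem cell_eqToHom_comp {a b : B} {f g h : a ⟶ b} (e : f = g) (η : g ⟶ h) :
    cell (eqToHom e ≫ η) = cell η := by
  subst e; simp

theorem cell_comp_eqToHom {a b : B} {f g h : a ⟶ b} (η : f ⟶ g) (e : g = h) :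
    cell (η ≫ eqToHom e) = cell η := by
  subst e; simp

theorem cell_eqToHom {a b : B} {f g : a ⟶ b} (e : f = g) :
    cell (eqToHom e) = cell₁ f := by
  subst e; rfl

/-- Turns a bundled 2-cell into a 2-cell between prescribed 1-cells, once its boundary is known only
propositionally. -/
theorem exists_cell_eq {a b : B} (x : Cells.mk a ⟶ Cells.mk b) {f g : a ⟶ b} (hf : x.src = f)
    (hg : x.tgt = g) : ∃ η : f ⟶ g, cell η = x := by
  subst hf hg
  exact ⟨x.hom, rfl⟩

theorem cell₁_comp {a b c : B} (f : a ⟶ b) (g : b ⟶ c) : cell₁ (f ≫ g) = cell₁ f ≫ cell₁ g :=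
  cell_eq (η := 𝟙 (f ≫ g)) (θ := 𝟙 f ▷ g ≫ f ◁ 𝟙 g) rfl rfl (by simp)

theorem cell_whiskerRight {a b c : B} {f g : a ⟶ b} (η : f ⟶ g) (h : b ⟶ c) :
    cell (η ▷ h) = cell η ≫ cell₁ h :=
  cell_eq (η := η ▷ h) (θ := η ▷ h ≫ g ◁ 𝟙 h) rfl rfl (by simp)

theorem cell_whiskerLeft {a b c : B} (f : a ⟶ b) {g h : b ⟶ c} (η : g ⟶ h) :
    cell (f ◁ η) = cell₁ f ≫ cell η :=
  cell_eq (η := f ◁ η) (θ := 𝟙 f ▷ g ≫ f ◁ η) rfl rfl (by simp)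

variable [Strict B]

attribute [local simp] Strict.leftUnitor_eqToIso Strict.rightUnitor_eqToIso
  Strict.associator_eqToIso

/-- The 2-cells of a 2-category form a category under horizontal composition. -/
instance : Category (Cells B) where
  id_comp x := Cell.ext_eqToHom (Strict.id_comp x.src) (Strict.id_comp x.tgt) (by
    simp [CategoryStruct.comp, CategoryStruct.id])
  comp_id x := Cell.ext_eqToHom (Strict.comp_id x.src) (Strict.comp_id x.tgt) (by
    simp [CategoryStruct.comp, CategoryStruct.id])
  assoc x y z := Cell.ext_eqToHom (Strict.assoc _ _ _) (Strict.assoc _ _ _) (by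
    simp [CategoryStruct.comp])

end Cells

/-! ### 2-functors and 2-natural transformations acting on bundled 2-cells. -/

section Functor

variable {B : Type u₁} [Bicategory.{w₁, v₁} B] {C : Type u₂} [Bicategory.{w₂, v₂} C]
/-- The action of a 2-functor on bundled 2-cells. -/
def mapCell (F : StrictPseudofunctor B C) {a b : B} (x : Cells.mk a ⟶ Cells.mk b) :
    Cells.mk (F.obj a) ⟶ Cells.mk (F.obj b) :=
  cell (F.map₂ x.hom)

theorem mapCell_cell (F : StrictPseudofunctor B C) {a b : B} {f g : a ⟶ b} (η : f ⟶ g) :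
    mapCell F (cell η) = cell (F.map₂ η) := rfl

theorem mapCell_cell₁ (F : StrictPseudofunctor B C) {a b : B} (f : a ⟶ b) :
    mapCell F (cell₁ f) = cell₁ (F.map f) := by
  rw [cell₁, mapCell_cell, PrelaxFunctor.map₂_id, cell₁]

theorem mapCell_comp (F : StrictPseudofunctor B C) {a b c : B} (x : Cells.mk a ⟶ Cells.mk b)
    (y : Cells.mk b ⟶ Cells.mk c) : mapCell F (x ≫ y) = mapCell F x ≫ mapCell F y := by
  refine cell_eq (f := F.map (x.src ≫ y.src)) (g := F.map (x.tgt ≫ y.tgt))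
    (η := F.map₂ (x.hom ▷ y.src ≫ x.tgt ◁ y.hom))
    (θ := F.map₂ x.hom ▷ F.map y.src ≫ F.map x.tgt ◁ F.map₂ y.hom)
    (F.map_comp _ _) (F.map_comp _ _) ?_
  simp [F.map₂_whisker_left, F.map₂_whisker_right, F.mapComp_eq_eqToIso]

theorem TwoNatTrans.cell_naturality {F G : StrictPseudofunctor B C} (τ : TwoNatTrans F G)
    {a b : B} (x : Cells.mk a ⟶ Cells.mk b) :
    mapCell F x ≫ cell₁ (τ.app b) = cell₁ (τ.app a) ≫ mapCell G x := by
  change cell (F.map₂ x.hom) ≫ _ = _ ≫ cell (G.map₂ x.hom)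
  rw [← cell_whiskerRight, ← cell_whiskerLeft]
  exact cell_eq _ _ (τ.naturality₂ x.hom)

end Functor

/-! ### Products and equalizers as universal properties of 2-cells. -/

section Limits

variable {B : Type u} [Bicategory.{w, v} B] [Strict B]

/-- The 1-dimensional property lifts source and target; the 2-dimensional one then lifts the 2-cell
between them. Uniqueness follows in the same order. -/
theorem IsTwoProduct.existsUnique_cell {P X Y : B} {p : P ⟶ X} {q : P ⟶ Y}
    (h : IsTwoProduct p q) {W : B} (α : Cells.mk W ⟶ Cells.mk X) (β : Cells.mk W ⟶ Cells.mk Y) :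
    ∃! γ : Cells.mk W ⟶ Cells.mk P, γ ≫ cell₁ p = α ∧ γ ≫ cell₁ q = β := by
  obtain ⟨l, ⟨lp, lq⟩, hl⟩ := h.exists_lift α.src β.src
  obtain ⟨m, ⟨mp, mq⟩, hm⟩ := h.exists_lift α.tgt β.tgt
  obtain ⟨α', rfl⟩ := exists_cell_eq α lp.symm mp.symm
  obtain ⟨β', rfl⟩ := exists_cell_eq β lq.symm mq.symm
  obtain ⟨γ, ⟨γp, γq⟩, hγ⟩ := h.exists_lift₂ l m α' β'
  refine ⟨cell γ, ⟨by rw [← cell_whiskerRight, γp], by rw [← cell_whiskerRight, γq]⟩, ?_⟩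
  rintro δ ⟨δp, δq⟩
  obtain ⟨δ, rfl⟩ := exists_cell_eq δ
    (hl _ ⟨(congrArg Cell.src δp).trans lp, (congrArg Cell.src δq).trans lq⟩)
    (hm _ ⟨(congrArg Cell.tgt δp).trans mp, (congrArg Cell.tgt δq).trans mq⟩)
  rw [← cell_whiskerRight] at δp δq
  rw [hγ δ ⟨cell_injective δp, cell_injective δq⟩]

/-- Applying the hypothesis to identity 2-cells recovers the 1-dimensional property. The lifted
2-cell need not be known to be an identity: its source is already the required 1-cell. -/
theorem IsTwoProduct.of_existsUnique_cell {P X Y : B} {p : P ⟶ X} {q : P ⟶ Y}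
    (h : ∀ {W : B} (α : Cells.mk W ⟶ Cells.mk X) (β : Cells.mk W ⟶ Cells.mk Y),
      ∃! γ : Cells.mk W ⟶ Cells.mk P, γ ≫ cell₁ p = α ∧ γ ≫ cell₁ q = β) :
    IsTwoProduct p q := by
  have hext {W : B} {l m : W ⟶ P} (hp : l ≫ p = m ≫ p) (hq : l ≫ q = m ≫ q) : l = m :=
    cell₁_injective ((h (cell₁ m ≫ cell₁ p) (cell₁ m ≫ cell₁ q)).unique
      ⟨by rw [← cell₁_comp, hp, cell₁_comp], by rw [← cell₁_comp, hq, cell₁_comp]⟩ ⟨rfl, rfl⟩)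
  refine ⟨fun {W} f g => ?_, fun {W} l m α β => ?_⟩
  · obtain ⟨γ, ⟨γp, γq⟩, -⟩ := h (cell₁ f) (cell₁ g)
    have hp : γ.src ≫ p = f := congrArg Cell.src γp
    have hq : γ.src ≫ q = g := congrArg Cell.src γq
    exact ⟨γ.src, ⟨hp, hq⟩, fun l hl => hext (hl.1.trans hp.symm) (hl.2.trans hq.symm)⟩
  · obtain ⟨γ, ⟨γp, γq⟩, hγ⟩ := h (cell α) (cell β)
    obtain ⟨γ, rfl⟩ := exists_cell_eq γ
      (hext (congrArg Cell.src γp) (congrArg Cell.src γq))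
      (hext (congrArg Cell.tgt γp) (congrArg Cell.tgt γq))
    rw [← cell_whiskerRight] at γp γq
    refine ⟨γ, ⟨cell_injective γp, cell_injective γq⟩, fun δ hδ => cell_injective (hγ _ ?_)⟩
    exact ⟨(cell_whiskerRight δ p).symm.trans (congrArg cell hδ.1),
      (cell_whiskerRight δ q).symm.trans (congrArg cell hδ.2)⟩

theorem IsTwoEqualizer.cell_condition {E X Y : B} {f g : X ⟶ Y} {i : E ⟶ X}
    (h : IsTwoEqualizer f g i) : cell₁ i ≫ cell₁ f = cell₁ i ≫ cell₁ g := by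
  rw [← cell₁_comp, h.condition, cell₁_comp]

theorem IsTwoEqualizer.existsUnique_cell {E X Y : B} {f g : X ⟶ Y} {i : E ⟶ X}
    (h : IsTwoEqualizer f g i) {W : B} (β : Cells.mk W ⟶ Cells.mk X)
    (hβ : β ≫ cell₁ f = β ≫ cell₁ g) :
    ∃! γ : Cells.mk W ⟶ Cells.mk E, γ ≫ cell₁ i = β := by
  obtain ⟨l, li, hl⟩ := h.exists_lift β.src (congrArg Cell.src hβ)
  obtain ⟨m, mi, hm⟩ := h.exists_lift β.tgt (congrArg Cell.tgt hβ)
  obtain ⟨β, rfl⟩ := exists_cell_eq β li.symm mi.symm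
  rw [← cell_whiskerRight, ← cell_whiskerRight] at hβ
  obtain ⟨γ, γi, hγ⟩ := h.exists_lift₂ l m β (comp_eqToHom_eq_of_cell_eq _ _ hβ)
  refine ⟨cell γ, (cell_whiskerRight γ i).symm.trans (by rw [γi]), fun δ δi => ?_⟩
  obtain ⟨δ, rfl⟩ := exists_cell_eq δ
    (hl _ ((congrArg Cell.src δi).trans li)) (hm _ ((congrArg Cell.tgt δi).trans mi))
  rw [← cell_whiskerRight] at δi
  rw [hγ δ (cell_injective δi)]

theorem IsTwoEqualizer.cell_hom_ext {E X Y : B} {f g : X ⟶ Y} {i : E ⟶ X}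
    (h : IsTwoEqualizer f g i) {W : B} {γ δ : Cells.mk W ⟶ Cells.mk E}
    (e : γ ≫ cell₁ i = δ ≫ cell₁ i) : γ = δ :=
  (h.existsUnique_cell (δ ≫ cell₁ i)
    (by simp only [Category.assoc, h.cell_condition])).unique e rfl

end Limits

/-! ### The 2-functor `Y × -` on bundled 2-cells. -/

namespace ProductsWith

variable {B : Type u} [Bicategory.{w, v} B] [Strict B] {Y : B} (c : ProductsWith Y)

/-- The bundled 2-cell `Y × k`. -/
def mapCell {X X' : B} (k : Cells.mk X ⟶ Cells.mk X') :
    Cells.mk (c.prod X) ⟶ Cells.mk (c.prod X') :=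
  cell (c.map₂ k.hom)

theorem mapCell_cell₁ {X X' : B} (f : X ⟶ X') : c.mapCell (cell₁ f) = cell₁ (c.map f) :=
  TwoCat.mapCell_cell₁ c.twoFunctor f

theorem mapCell_comp {X X' X'' : B} (k : Cells.mk X ⟶ Cells.mk X')
    (l : Cells.mk X' ⟶ Cells.mk X'') : c.mapCell (k ≫ l) = c.mapCell k ≫ c.mapCell l :=
  TwoCat.mapCell_comp c.twoFunctor k l

theorem mapCell_fst {X X' : B} (k : Cells.mk X ⟶ Cells.mk X') :
    c.mapCell k ≫ cell₁ (c.fst X') = cell₁ (c.fst X) := by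
  rw [mapCell, ← cell_whiskerRight, c.map₂_fst, cell_eqToHom, c.map_fst]

theorem mapCell_snd {X X' : B} (k : Cells.mk X ⟶ Cells.mk X') :
    c.mapCell k ≫ cell₁ (c.snd X') = cell₁ (c.snd X) ≫ k := by
  rw [mapCell, ← cell_whiskerRight, c.map₂_snd, cell_eqToHom_comp, cell_comp_eqToHom,
    cell_whiskerLeft]
  rfl

theorem cell_hom_ext {W X : B} {l m : Cells.mk W ⟶ Cells.mk (c.prod X)}
    (h₁ : l ≫ cell₁ (c.fst X) = m ≫ cell₁ (c.fst X))
    (h₂ : l ≫ cell₁ (c.snd X) = m ≫ cell₁ (c.snd X)) : l = m :=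
  ((c.isTwoProduct X).existsUnique_cell _ _).unique ⟨h₁, h₂⟩ ⟨rfl, rfl⟩

end ProductsWith

/-! ### Universal arrows and right 2-adjoints. -/

section Universal

variable {B : Type u₁} [Bicategory.{w₁, v₁} B] {C : Type u₂} [Bicategory.{w₂, v₂} C]

/-- A 2-categorical universal arrow from the 2-functor `F` to `z`: for every `X`, the functor
`B(X, E) ⥤ C(F X, z)` induced by `ev` is an isomorphism of categories. -/
structure IsTwoUniversal (F : StrictPseudofunctor B C) {E : B} {z : C} (ev : F.obj E ⟶ z) :
    Prop where
  exists_lift {X : B} (f : F.obj X ⟶ z) : ∃! l : X ⟶ E, F.map l ≫ ev = f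
  exists_lift₂ {X : B} (l m : X ⟶ E) (β : F.map l ≫ ev ⟶ F.map m ≫ ev) :
    ∃! γ : l ⟶ m, F.map₂ γ ▷ ev = β

variable {F : StrictPseudofunctor B C}

namespace IsTwoUniversal

/-- The factorization of a 1-cell through a universal arrow. -/
def lift {E : B} {z : C} {ev : F.obj E ⟶ z} (h : IsTwoUniversal F ev) {X : B} (f : F.obj X ⟶ z) :
    X ⟶ E :=
  (h.exists_lift f).choose

theorem lift_spec {E : B} {z : C} {ev : F.obj E ⟶ z} (h : IsTwoUniversal F ev) {X : B}
    (f : F.obj X ⟶ z) : F.map (h.lift f) ≫ ev = f :=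
  (h.exists_lift f).choose_spec.1

theorem hom_ext {E : B} {z : C} {ev : F.obj E ⟶ z} (h : IsTwoUniversal F ev) {X : B}
    {l m : X ⟶ E} (e : F.map l ≫ ev = F.map m ≫ ev) : l = m :=
  (h.exists_lift _).unique e rfl

/-- The factorization of a 2-cell through a universal arrow. -/
def lift₂ {E : B} {z : C} {ev : F.obj E ⟶ z} (h : IsTwoUniversal F ev) {X : B} {l m : X ⟶ E}
    (β : F.map l ≫ ev ⟶ F.map m ≫ ev) : l ⟶ m :=
  (h.exists_lift₂ l m β).choose

theorem lift₂_spec {E : B} {z : C} {ev : F.obj E ⟶ z} (h : IsTwoUniversal F ev) {X : B}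
    {l m : X ⟶ E} (β : F.map l ≫ ev ⟶ F.map m ≫ ev) : F.map₂ (h.lift₂ β) ▷ ev = β :=
  (h.exists_lift₂ l m β).choose_spec.1

theorem hom₂_ext {E : B} {z : C} {ev : F.obj E ⟶ z} (h : IsTwoUniversal F ev) {X : B}
    {l m : X ⟶ E} {γ δ : l ⟶ m} (e : F.map₂ γ ▷ ev = F.map₂ δ ▷ ev) : γ = δ :=
  (h.exists_lift₂ l m _).unique e rfl

variable {G : C → B} {ev : ∀ z, F.obj (G z) ⟶ z} (h : ∀ z, IsTwoUniversal F (ev z))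

/-- The action on 1-cells of the right 2-adjoint obtained from universal arrows. -/
def map {z z' : C} (f : z ⟶ z') : G z ⟶ G z' :=
  (h z').lift (ev z ≫ f)

theorem map_ev {z z' : C} (f : z ⟶ z') : F.map (map h f) ≫ ev z' = ev z ≫ f :=
  (h z').lift_spec _

/-- The action on 2-cells of the right 2-adjoint obtained from universal arrows. -/
def map₂ {z z' : C} {f g : z ⟶ z'} (η : f ⟶ g) : map h f ⟶ map h g :=
  (h z').lift₂ (eqToHom (map_ev h f) ≫ ev z ◁ η ≫ eqToHom (map_ev h g).symm)

theorem map₂_ev {z z' : C} {f g : z ⟶ z'} (η : f ⟶ g) :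
    F.map₂ (map₂ h η) ▷ ev z' =
      eqToHom (map_ev h f) ≫ ev z ◁ η ≫ eqToHom (map_ev h g).symm :=
  (h z').lift₂_spec _

end IsTwoUniversal
theorem naturality₂_of_cell {F G : StrictPseudofunctor B C} {app : ∀ a, F.obj a ⟶ G.obj a}
    (naturality : ∀ {a b : B} (f : a ⟶ b), F.map f ≫ app b = app a ≫ G.map f)
    {a b : B} {f g : a ⟶ b} (η : f ⟶ g)
    (e : mapCell F (cell η) ≫ cell₁ (app b) = cell₁ (app a) ≫ mapCell G (cell η)) :
    F.map₂ η ▷ app b ≫ eqToHom (naturality g) = eqToHom (naturality f) ≫ app a ◁ G.map₂ η :=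
  comp_eqToHom_eq_of_cell_eq _ _ (by
    rw [cell_whiskerRight, cell_whiskerLeft]
    exact e)

variable [Strict C]

theorem IsTwoUniversal.existsUnique_cell {E : B} {z : C} {ev : F.obj E ⟶ z}
    (h : IsTwoUniversal F ev) {X : B} (β : Cells.mk (F.obj X) ⟶ Cells.mk z) :
    ∃! γ : Cells.mk X ⟶ Cells.mk E, mapCell F γ ≫ cell₁ ev = β := by
  obtain ⟨l, le, hl⟩ := h.exists_lift β.src
  obtain ⟨m, me, hm⟩ := h.exists_lift β.tgt
  obtain ⟨β, rfl⟩ := exists_cell_eq β le.symm me.symm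
  obtain ⟨γ, γe, hγ⟩ := h.exists_lift₂ l m β
  refine ⟨cell γ, (cell_whiskerRight (F.map₂ γ) ev).symm.trans (by rw [γe]), fun δ δe => ?_⟩
  obtain ⟨δ, rfl⟩ := exists_cell_eq δ
    (hl _ ((congrArg Cell.src δe).trans le)) (hm _ ((congrArg Cell.tgt δe).trans me))
  rw [hγ δ (cell_injective ((cell_whiskerRight (F.map₂ δ) ev).trans δe))]

theorem IsTwoUniversal.of_existsUnique_cell {E : B} {z : C} {ev : F.obj E ⟶ z}
    (h : ∀ {X : B} (β : Cells.mk (F.obj X) ⟶ Cells.mk z),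
      ∃! γ : Cells.mk X ⟶ Cells.mk E, mapCell F γ ≫ cell₁ ev = β) :
    IsTwoUniversal F ev := by
  have hext {X : B} {l m : X ⟶ E} (e : F.map l ≫ ev = F.map m ≫ ev) : l = m :=
    cell₁_injective ((h (cell₁ (F.map m ≫ ev))).unique
      (by rw [mapCell_cell₁, ← e, cell₁_comp])
      (by rw [mapCell_cell₁, cell₁_comp]))
  refine ⟨fun {X} f => ?_, fun {X} l m β => ?_⟩
  · obtain ⟨γ, γe, -⟩ := h (cell₁ f)
    have he : F.map γ.src ≫ ev = f := congrArg Cell.src γe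
    exact ⟨γ.src, he, fun l hl => hext (hl.trans he.symm)⟩
  · obtain ⟨γ, γe, hγ⟩ := h (cell β)
    obtain ⟨γ, rfl⟩ := exists_cell_eq γ (hext (congrArg Cell.src γe)) (hext (congrArg Cell.tgt γe))
    refine ⟨γ, cell_injective ((cell_whiskerRight (F.map₂ γ) ev).trans γe),
      fun δ hδ => cell_injective (hγ _ ?_)⟩
    exact (cell_whiskerRight (F.map₂ δ) ev).symm.trans (by rw [hδ])

theorem IsTwoUniversal.cell_hom_ext {E : B} {z : C} {ev : F.obj E ⟶ z}
    (h : IsTwoUniversal F ev) {X : B} {γ δ : Cells.mk X ⟶ Cells.mk E}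
    (e : mapCell F γ ≫ cell₁ ev = mapCell F δ ≫ cell₁ ev) : γ = δ :=
  (h.existsUnique_cell _).unique e rfl

namespace IsTwoUniversal

variable {G : C → B} {ev : ∀ z, F.obj (G z) ⟶ z} (h : ∀ z, IsTwoUniversal F (ev z))

theorem cell_map₂_ev {z z' : C} {f g : z ⟶ z'} (η : f ⟶ g) :
    mapCell F (cell (map₂ h η)) ≫ cell₁ (ev z') = cell₁ (ev z) ≫ cell η := by
  refine (cell_whiskerRight (F.map₂ (map₂ h η)) (ev z')).symm.trans ?_
  rw [map₂_ev, cell_eqToHom_comp, cell_comp_eqToHom, cell_whiskerLeft]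

theorem cell_map_ev {z z' : C} (f : z ⟶ z') :
    mapCell F (cell₁ (map h f)) ≫ cell₁ (ev z') = cell₁ (ev z) ≫ cell₁ f := by
  rw [mapCell_cell₁, ← cell₁_comp, map_ev h f, cell₁_comp]

theorem map_id (z : C) : map h (𝟙 z) = 𝟙 (G z) := by
  apply (h z).hom_ext
  rw [map_ev, F.map_id, Strict.comp_id, Strict.id_comp]

theorem map_comp {z z' z'' : C} (f : z ⟶ z') (g : z' ⟶ z'') :
    map h (f ≫ g) = map h f ≫ map h g := by
  apply (h z'').hom_ext
  rw [map_ev, F.map_comp, Strict.assoc, map_ev h g, ← Strict.assoc, ← Strict.assoc, map_ev h f]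

variable [Strict B]

/-- The right 2-adjoint obtained from universal arrows. -/
def rightAdjoint : StrictPseudofunctor C B :=
  StrictPseudofunctor.mk''
    { obj := G
      map := map h
      map₂ := map₂ h
      map₂_id := fun f => (h _).hom₂_ext (by simp [map₂_ev])
      map₂_comp := fun η θ => (h _).hom₂_ext (by simp [map₂_ev])
      map_id := map_id h
      map_comp := map_comp h
      map₂_whisker_left := fun {a b c} f g g' η => by
        refine cell_injective ((h c).cell_hom_ext ?_)
        rw [cell_map₂_ev, cell_eqToHom_comp, cell_comp_eqToHom, cell_whiskerLeft,
          cell_whiskerLeft, mapCell_comp, Category.assoc, cell_map₂_ev, ← Category.assoc,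
          ← cell_map_ev, Category.assoc]
      map₂_whisker_right := fun {a b c} f f' η g => by
        refine cell_injective ((h c).cell_hom_ext ?_)
        rw [cell_map₂_ev, cell_eqToHom_comp, cell_comp_eqToHom, cell_whiskerRight,
          cell_whiskerRight, mapCell_comp, Category.assoc, cell_map_ev, ← Category.assoc,
          ← cell_map₂_ev, Category.assoc] }

end IsTwoUniversal

variable [Strict B]

/-- The counit of a 2-adjunction is a universal arrow. -/
theorem TwoAdjunction.isTwoUniversal {G : StrictPseudofunctor C B} (adj : TwoAdjunction F G)
    (z : C) : IsTwoUniversal F (E := G.obj z) (adj.counit.app z) := by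
  have unit_nat {X Y : B} (k : Cells.mk X ⟶ Cells.mk Y) :
      k ≫ cell₁ (adj.unit.app Y) = cell₁ (adj.unit.app X) ≫ mapCell G (mapCell F k) :=
    adj.unit.cell_naturality k
  have counit_nat {X Y : C} (k : Cells.mk X ⟶ Cells.mk Y) :
      mapCell F (mapCell G k) ≫ cell₁ (adj.counit.app Y) =
        cell₁ (adj.counit.app X) ≫ k :=
    adj.counit.cell_naturality k
  have left (X : B) : mapCell F (cell₁ (adj.unit.app X)) ≫ cell₁ (adj.counit.app (F.obj X)) =
      𝟙 (Cells.mk (F.obj X)) := by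
    rw [mapCell_cell₁]
    exact (cell₁_comp _ _).symm.trans (congrArg cell₁ (adj.left_triangle X))
  have right : cell₁ (adj.unit.app (G.obj z)) ≫ mapCell G (cell₁ (adj.counit.app z)) =
      𝟙 (Cells.mk (G.obj z)) := by
    refine (congrArg (_ ≫ ·) (mapCell_cell₁ G _)).trans ?_
    exact (cell₁_comp _ _).symm.trans (congrArg cell₁ (adj.right_triangle z))
  -- The usual transpose: existence uses naturality of the counit and the left triangle, uniqueness
  -- naturality of the unit and the right triangle.
  refine .of_existsUnique_cell fun {X} β =>
    ⟨cell₁ (adj.unit.app X) ≫ mapCell G β, ?_, fun δ hδ => ?_⟩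
  · have nat := counit_nat β
    have := congrArg (· ≫ β) (left X)
    exact (congrArg (· ≫ cell₁ (adj.counit.app z)) (mapCell_comp F _ _)).trans
      ((Category.assoc _ _ _).trans ((congrArg (_ ≫ ·) nat).trans
        ((Category.assoc _ _ _).symm.trans (this.trans (Category.id_comp β)))))
  · subst hδ
    have nat := congrArg (· ≫ mapCell G (cell₁ (adj.counit.app z))) (unit_nat δ)
    have := congrArg (δ ≫ ·) right
    exact (this.trans (Category.comp_id δ)).symm.trans ((Category.assoc _ _ _).symm.trans
      (nat.trans ((Category.assoc _ _ _).trans (congrArg (_ ≫ ·) (mapCell_comp G _ _).symm))))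

/-- A 2-functor has a right 2-adjoint if there is a universal arrow to every object. -/
theorem HasRightTwoAdjoint.of_isTwoUniversal {G : C → B} {ev : ∀ z, F.obj (G z) ⟶ z}
    (h : ∀ z, IsTwoUniversal F (ev z)) : HasRightTwoAdjoint F := by
  -- The unit is the transpose of the identity, so the left triangle is its defining equation. The
  -- remaining laws are equations into some `G z` and are tested after evaluation.
  have unit_ev (X : B) : F.map ((h (F.obj X)).lift (𝟙 _)) ≫ ev (F.obj X) = 𝟙 (F.obj X) :=
    (h _).lift_spec _
  have cell_unit_ev (X : B) : mapCell F (cell₁ ((h (F.obj X)).lift (𝟙 _))) ≫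
      cell₁ (ev (F.obj X)) = 𝟙 (Cells.mk (F.obj X)) := by
    rw [mapCell_cell₁]
    exact (cell₁_comp _ _).symm.trans (congrArg cell₁ (unit_ev X))
  have unit_nat {X Y : B} (k : X ⟶ Y) : k ≫ (h (F.obj Y)).lift (𝟙 _) =
      (h (F.obj X)).lift (𝟙 _) ≫ IsTwoUniversal.map h (F.map k) := by
    apply (h _).hom_ext
    rw [F.map_comp, Strict.assoc, unit_ev, F.map_comp, Strict.assoc, IsTwoUniversal.map_ev,
      ← Strict.assoc, unit_ev, Strict.id_comp, Strict.comp_id]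
  refine ⟨IsTwoUniversal.rightAdjoint h, ⟨{
    unit :=
      { app := fun X => (h (F.obj X)).lift (𝟙 _)
        naturality := unit_nat
        naturality₂ := fun {X Y f g} η => ?_ }
    counit :=
      { app := ev
        naturality := IsTwoUniversal.map_ev h
        naturality₂ := fun {X Y f g} η => ?_ }
    left_triangle := unit_ev
    right_triangle := fun z => ?_ }⟩⟩
  · refine naturality₂_of_cell (F := .id B) (G := F.comp (IsTwoUniversal.rightAdjoint h))
      unit_nat η ((h _).cell_hom_ext ?_)
    change mapCell F (cell η ≫ cell₁ _) ≫ _ = mapCell F (cell₁ ((h (F.obj X)).lift (𝟙 _)) ≫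
      cell (IsTwoUniversal.map₂ h (F.map₂ η))) ≫ _
    rw [mapCell_comp, mapCell_comp, Category.assoc, Category.assoc, cell_unit_ev,
      IsTwoUniversal.cell_map₂_ev, reassoc_of% cell_unit_ev X]
    exact Category.comp_id _
  · exact naturality₂_of_cell (F := (IsTwoUniversal.rightAdjoint h).comp F) (G := .id C)
      (IsTwoUniversal.map_ev h) η (IsTwoUniversal.cell_map₂_ev h η)
  · refine (h z).hom_ext ?_
    change F.map ((h _).lift (𝟙 _) ≫ IsTwoUniversal.map h (ev z)) ≫ ev z = F.map (𝟙 _) ≫ ev z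
    rw [F.map_comp, Strict.assoc, IsTwoUniversal.map_ev, ← Strict.assoc, unit_ev, F.map_id]

end Universal

/-! ### Comonad and coalgebra laws in the category of 2-cells. -/

namespace TwoComonad

variable {B : Type u} [Bicategory.{w, v} B] (S : TwoComonad B)

/-- The counit of a 2-comonad at `a`. -/
def extract (a : B) : S.F.obj a ⟶ a := S.counit.app a

/-- The comultiplication of a 2-comonad at `a`. -/
def duplicate (a : B) : S.F.obj a ⟶ S.F.obj (S.F.obj a) := S.comul.app a

theorem cell_duplicate_extract (a : B) :
    cell₁ (S.duplicate a) ≫ cell₁ (S.extract (S.F.obj a)) = 𝟙 (Cells.mk (S.F.obj a)) :=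
  (cell₁_comp _ _).symm.trans (congrArg cell₁ (S.counit_comul a))

theorem cell_duplicate_mapCell_extract (a : B) :
    cell₁ (S.duplicate a) ≫ mapCell S.F (cell₁ (S.extract a)) = 𝟙 (Cells.mk (S.F.obj a)) := by
  rw [mapCell_cell₁, ← cell₁_comp]
  exact congrArg cell₁ (S.comul_counit a)

theorem cell_duplicate_duplicate (a : B) :
    cell₁ (S.duplicate a) ≫ cell₁ (S.duplicate (S.F.obj a)) =
      cell₁ (S.duplicate a) ≫ mapCell S.F (cell₁ (S.duplicate a)) := by
  rw [mapCell_cell₁, ← cell₁_comp, ← cell₁_comp]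
  exact congrArg cell₁ (S.coassoc a)

variable {S} in
theorem CoAlg.cell_str_extract (x : CoAlg S) :
    cell₁ x.str ≫ cell₁ (S.extract x.carrier) = 𝟙 (Cells.mk x.carrier) :=
  (cell₁_comp _ _).symm.trans (congrArg cell₁ x.counit)

variable {S} in
theorem CoAlg.cell_str_duplicate (x : CoAlg S) :
    cell₁ x.str ≫ cell₁ (S.duplicate x.carrier) = cell₁ x.str ≫ mapCell S.F (cell₁ x.str) := by
  rw [mapCell_cell₁, ← cell₁_comp, ← cell₁_comp]
  exact congrArg cell₁ x.coassoc

variable [Strict B]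

theorem mapCell_extract {a b : B} (k : Cells.mk a ⟶ Cells.mk b) :
    mapCell S.F k ≫ cell₁ (S.extract b) = cell₁ (S.extract a) ≫ k :=
  S.counit.cell_naturality k

theorem mapCell_duplicate {a b : B} (k : Cells.mk a ⟶ Cells.mk b) :
    mapCell S.F k ≫ cell₁ (S.duplicate b) = cell₁ (S.duplicate a) ≫ mapCell S.F (mapCell S.F k) :=
  S.comul.cell_naturality k

namespace CoAlg

variable {S}

/-- A strict coalgebra from the coalgebra laws in the category of 2-cells. -/
abbrev ofCell {X : B} (a : X ⟶ S.F.obj X) (h₁ : cell₁ a ≫ cell₁ (S.extract X) = 𝟙 (Cells.mk X))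
    (h₂ : cell₁ a ≫ cell₁ (S.duplicate X) = cell₁ a ≫ mapCell S.F (cell₁ a)) : CoAlg S where
  carrier := X
  str := a
  counit := cell₁_injective ((cell₁_comp _ _).trans h₁)
  coassoc := cell₁_injective ((cell₁_comp _ _).trans (h₂.trans (by
    rw [mapCell_cell₁, ← cell₁_comp]; rfl)))

/-- A strict morphism of coalgebras from its law in the category of 2-cells. -/
def homOfCell {x y : CoAlg S} (f : x.carrier ⟶ y.carrier)
    (h : cell₁ x.str ≫ mapCell S.F (cell₁ f) = cell₁ f ≫ cell₁ y.str) : x ⟶ y where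
  f := f
  comm := cell₁_injective (by rw [cell₁_comp, cell₁_comp, ← h, mapCell_cell₁])

/-- The bundled 2-cell underlying a bundled 2-cell of coalgebras. -/
def cellα {x y : CoAlg S} (k : Cells.mk x ⟶ Cells.mk y) :
    Cells.mk x.carrier ⟶ Cells.mk y.carrier :=
  cell k.hom.α

theorem cellα_cell₁ {x y : CoAlg S} (f : x ⟶ y) : cellα (cell₁ f) = cell₁ f.f := rfl

theorem cellα_comp {x y z : CoAlg S} (k : Cells.mk x ⟶ Cells.mk y)
    (l : Cells.mk y ⟶ Cells.mk z) : cellα (k ≫ l) = cellα k ≫ cellα l := rfl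

theorem cellα_injective {x y : CoAlg S} {k l : Cells.mk x ⟶ Cells.mk y}
    (h : cellα k = cellα l) : k = l := by
  refine Cell.ext_eqToHom (hom_ext (congrArg Cell.src h)) (hom_ext (congrArg Cell.tgt h))
    (hom₂_ext ?_)
  rw [comp_α, comp_α, eqToHom_α, eqToHom_α]
  exact Cell.hom_eq_of_eq h

theorem cellα_comm {x y : CoAlg S} (k : Cells.mk x ⟶ Cells.mk y) :
    cell₁ x.str ≫ mapCell S.F (cellα k) = cellα k ≫ cell₁ y.str := by
  rw [cellα, mapCell_cell, ← cell_whiskerLeft, ← cell_whiskerRight]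
  exact cell_eq _ _ k.hom.comm

/-- A single equation suffices: its source and target say that the two boundary 1-cells are
coalgebra morphisms. -/
theorem exists_cellα_eq {x y : CoAlg S} (k : Cells.mk x.carrier ⟶ Cells.mk y.carrier)
    (h : cell₁ x.str ≫ mapCell S.F k = k ≫ cell₁ y.str) :
    ∃ l : Cells.mk x ⟶ Cells.mk y, cellα l = k := by
  let f : x ⟶ y := ⟨k.src, congrArg Cell.src h⟩
  let g : x ⟶ y := ⟨k.tgt, congrArg Cell.tgt h⟩
  let η : f ⟶ g := ⟨k.hom, comp_eqToHom_eq_of_cell_eq _ _ (by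
    rw [cell_whiskerLeft, cell_whiskerRight]
    exact h)⟩
  exact ⟨cell η, rfl⟩

/-! ### Products of coalgebras. -/

section Product

variable {y : CoAlg S} (c : ProductsWith y.carrier) (hS : PreservesTwoProducts S.F)

include hS in
-- Since `S (Y × X)` is a product of `S Y` and `S X`, the 1-cell is induced by `y.str` on the first
-- factor and the identity on the second.
theorem exists_strength (X : B) : ∃ u : c.prod (S.F.obj X) ⟶ S.F.obj (c.prod X),
    cell₁ u ≫ mapCell S.F (cell₁ (c.fst X)) = cell₁ (c.fst _) ≫ cell₁ y.str ∧
    cell₁ u ≫ mapCell S.F (cell₁ (c.snd X)) = cell₁ (c.snd _) := by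
  obtain ⟨u, ⟨h₁, h₂⟩, -⟩ := (hS _ _ (c.isTwoProduct X)).exists_lift
    (c.fst (S.F.obj X) ≫ y.str) (c.snd (S.F.obj X))
  refine ⟨u, ?_, ?_⟩
  · rw [mapCell_cell₁, ← cell₁_comp, h₁, cell₁_comp]
  · rw [mapCell_cell₁, ← cell₁_comp, h₂]

/-- The canonical 1-cell `Y × S X ⟶ S (Y × X)` for a coalgebra structure on `Y`. -/
def strength (X : B) : c.prod (S.F.obj X) ⟶ S.F.obj (c.prod X) :=
  (exists_strength c hS X).choose

theorem cell_strength_fst (X : B) : cell₁ (strength c hS X) ≫ mapCell S.F (cell₁ (c.fst X)) =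
    cell₁ (c.fst _) ≫ cell₁ y.str :=
  (exists_strength c hS X).choose_spec.1

theorem cell_strength_snd (X : B) : cell₁ (strength c hS X) ≫ mapCell S.F (cell₁ (c.snd X)) =
    cell₁ (c.snd _) :=
  (exists_strength c hS X).choose_spec.2

include hS in
theorem cell_map_prod_hom_ext {W X : B} {k l : Cells.mk W ⟶ Cells.mk (S.F.obj (c.prod X))}
    (h₁ : k ≫ mapCell S.F (cell₁ (c.fst X)) = l ≫ mapCell S.F (cell₁ (c.fst X)))
    (h₂ : k ≫ mapCell S.F (cell₁ (c.snd X)) = l ≫ mapCell S.F (cell₁ (c.snd X))) : k = l := by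
  rw [mapCell_cell₁] at h₁ h₂
  exact ((hS _ _ (c.isTwoProduct X)).existsUnique_cell _ _).unique ⟨h₁, h₂⟩ ⟨rfl, rfl⟩

theorem mapCell_strength {X X' : B} (k : Cells.mk X ⟶ Cells.mk X') :
    c.mapCell (mapCell S.F k) ≫ cell₁ (strength c hS X') =
      cell₁ (strength c hS X) ≫ mapCell S.F (c.mapCell k) := by
  apply cell_map_prod_hom_ext c hS
  · simp only [Category.assoc, cell_strength_fst, ← mapCell_comp, c.mapCell_fst,
      reassoc_of% c.mapCell_fst]
  · simp only [Category.assoc, cell_strength_snd, ← mapCell_comp, c.mapCell_snd]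
    simp only [mapCell_comp, reassoc_of% cell_strength_snd c hS]

/-- The structure 1-cell of the product of the coalgebras `y` and `x`. -/
def prodStr (x : CoAlg S) : c.prod x.carrier ⟶ S.F.obj (c.prod x.carrier) :=
  c.map x.str ≫ strength c hS x.carrier

theorem cell_prodStr (x : CoAlg S) : cell₁ (prodStr c hS x) =
    c.mapCell (cell₁ x.str) ≫ cell₁ (strength c hS x.carrier) := by
  rw [prodStr, cell₁_comp, c.mapCell_cell₁]

theorem cell_prodStr_fst (x : CoAlg S) :
    cell₁ (prodStr c hS x) ≫ mapCell S.F (cell₁ (c.fst x.carrier)) =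
      cell₁ (c.fst x.carrier) ≫ cell₁ y.str := by
  rw [cell_prodStr, Category.assoc, cell_strength_fst, reassoc_of% c.mapCell_fst]

theorem cell_prodStr_snd (x : CoAlg S) :
    cell₁ (prodStr c hS x) ≫ mapCell S.F (cell₁ (c.snd x.carrier)) =
      cell₁ (c.snd x.carrier) ≫ cell₁ x.str := by
  rw [cell_prodStr, Category.assoc, cell_strength_snd, c.mapCell_snd]

/-- The product of the coalgebras `y` and `x`. -/
abbrev prod (x : CoAlg S) : CoAlg S :=
  ofCell (prodStr c hS x)
    (by
      apply c.cell_hom_ext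
      · rw [Category.assoc, ← S.mapCell_extract, reassoc_of% cell_prodStr_fst c hS,
          cell_str_extract, Category.comp_id, Category.id_comp]
      · rw [Category.assoc, ← S.mapCell_extract, reassoc_of% cell_prodStr_snd c hS,
          cell_str_extract, Category.comp_id, Category.id_comp])
    (by
      -- Preservation used twice: `S S (Y × X)` is again a product, so coassociativity is checked on
      -- projections.
      have hSS {W : B} {k l : Cells.mk W ⟶ Cells.mk (S.F.obj (S.F.obj (c.prod x.carrier)))}
          (h₁ : k ≫ mapCell S.F (mapCell S.F (cell₁ (c.fst _))) =
            l ≫ mapCell S.F (mapCell S.F (cell₁ (c.fst _))))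
          (h₂ : k ≫ mapCell S.F (mapCell S.F (cell₁ (c.snd _))) =
            l ≫ mapCell S.F (mapCell S.F (cell₁ (c.snd _)))) : k = l := by
        rw [mapCell_cell₁, mapCell_cell₁] at h₁ h₂
        exact ((hS _ _ (hS _ _ (c.isTwoProduct _))).existsUnique_cell _ _).unique
          ⟨h₁, h₂⟩ ⟨rfl, rfl⟩
      apply hSS
      · rw [Category.assoc, ← S.mapCell_duplicate, reassoc_of% cell_prodStr_fst c hS,
          cell_str_duplicate, Category.assoc, ← mapCell_comp, cell_prodStr_fst, mapCell_comp,
          reassoc_of% cell_prodStr_fst c hS]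
      · rw [Category.assoc, ← S.mapCell_duplicate, reassoc_of% cell_prodStr_snd c hS,
          cell_str_duplicate, Category.assoc, ← mapCell_comp, cell_prodStr_snd, mapCell_comp,
          reassoc_of% cell_prodStr_snd c hS])

/-- The projection to `y`. -/
def fst (x : CoAlg S) : prod c hS x ⟶ y :=
  homOfCell (x := prod c hS x) (c.fst x.carrier) (cell_prodStr_fst c hS x)

/-- The projection to `x`. -/
def snd (x : CoAlg S) : prod c hS x ⟶ x :=
  homOfCell (x := prod c hS x) (c.snd x.carrier) (cell_prodStr_snd c hS x)

/-- The lift computed in `B` automatically respects the coalgebra structures, by comparing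
projections in `S (Y × X)`. -/
theorem isTwoProduct_prod (x : CoAlg S) : IsTwoProduct (fst c hS x) (snd c hS x) := by
  refine .of_existsUnique_cell fun {W} α β => ?_
  obtain ⟨γ, ⟨h₁, h₂⟩, hγ⟩ := (c.isTwoProduct x.carrier).existsUnique_cell (cellα α) (cellα β)
  obtain ⟨γ, rfl⟩ : ∃ l : Cells.mk W ⟶ Cells.mk (prod c hS x), cellα l = γ := by
    apply exists_cellα_eq
    apply cell_map_prod_hom_ext c hS
    · rw [Category.assoc, ← mapCell_comp, h₁, cellα_comm, ← h₁, Category.assoc, Category.assoc]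
      exact congrArg (γ ≫ ·) (cell_prodStr_fst c hS x).symm
    · rw [Category.assoc, ← mapCell_comp, h₂, cellα_comm, ← h₂, Category.assoc, Category.assoc]
      exact congrArg (γ ≫ ·) (cell_prodStr_snd c hS x).symm
  refine ⟨γ, ⟨cellα_injective h₁, cellα_injective h₂⟩, fun l hl => cellα_injective (hγ _ ?_)⟩
  exact ⟨congrArg cellα hl.1, congrArg cellα hl.2⟩

/-- The products `y × x` in the 2-category of strict coalgebras. -/
abbrev productsWith : ProductsWith y where
  prod := prod c hS
  fst := fst c hS
  snd := snd c hS
  isTwoProduct := isTwoProduct_prod c hS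

theorem cellα_productsWith_mapCell {x x' : CoAlg S} (k : Cells.mk x ⟶ Cells.mk x') :
    cellα ((productsWith c hS).mapCell k) = c.mapCell (cellα k) := by
  apply c.cell_hom_ext
  · rw [c.mapCell_fst]
    exact congrArg cellα ((productsWith c hS).mapCell_fst k)
  · rw [c.mapCell_snd]
    exact congrArg cellα ((productsWith c hS).mapCell_snd k)

end Product

/-! ### Equalizers of morphisms of cofree coalgebras. -/

section Equalizer

/-- For 1-cells `f : W ⟶ V` and `g : S W ⟶ V`, the coalgebra morphisms from `x` to the equalizer of
the induced pair of morphisms of cofree coalgebras correspond to the `k : x ⟶ W` such that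
`k ≫ f = x.str ≫ S k ≫ g`. -/
theorem exists_equalizer (heq : HasTwoEqualizers B) (hS : PreservesTwoEqualizers S.F) {W V : B}
    (f : W ⟶ V) (g : S.F.obj W ⟶ V) :
    ∃ (E : CoAlg S) (e : E.carrier ⟶ W),
      cell₁ e ≫ cell₁ f = cell₁ E.str ≫ mapCell S.F (cell₁ e) ≫ cell₁ g ∧
      ∀ (x : CoAlg S) (k : Cells.mk x.carrier ⟶ Cells.mk W),
        k ≫ cell₁ f = cell₁ x.str ≫ mapCell S.F k ≫ cell₁ g →
        ∃! l : Cells.mk x ⟶ Cells.mk E, cellα l ≫ cell₁ e = k := by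
  -- The parallel pair consists of the coalgebra morphisms `S W ⟶ S V` that correspond, by
  -- cofreeness, to `S.extract W ≫ f` and `g`.
  obtain ⟨E, i, hi⟩ := heq _ _ (S.F.map f) (S.duplicate W ≫ S.F.map g)
  have hSi := hS _ _ _ hi
  have cond : cell₁ i ≫ mapCell S.F (cell₁ f) =
      cell₁ i ≫ cell₁ (S.duplicate W) ≫ mapCell S.F (cell₁ g) := by
    rw [mapCell_cell₁, mapCell_cell₁, hi.cell_condition, cell₁_comp]
  -- Thus `i ≫ S.duplicate W` equalizes the image of the pair under `S`. As `S i` is the equalizer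
  -- of that image, the comultiplication restricts to a structure `a` on `E`.
  have cond' : (cell₁ i ≫ cell₁ (S.duplicate W)) ≫ mapCell S.F (mapCell S.F (cell₁ f)) =
      (cell₁ i ≫ cell₁ (S.duplicate W)) ≫
        mapCell S.F (cell₁ (S.duplicate W) ≫ mapCell S.F (cell₁ g)) := by
    rw [mapCell_comp, Category.assoc, Category.assoc, ← S.mapCell_duplicate, reassoc_of% cond,
      S.mapCell_duplicate, reassoc_of% S.cell_duplicate_duplicate]
  simp only [mapCell_cell₁, ← cell₁_comp] at cond'
  obtain ⟨a, ha, -⟩ := hSi.exists_lift _ (cell₁_injective cond')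
  replace ha : cell₁ a ≫ mapCell S.F (cell₁ i) = cell₁ i ≫ cell₁ (S.duplicate W) := by
    rw [mapCell_cell₁, ← cell₁_comp, ha, cell₁_comp]
  -- `S i` and `S S i` are again equalizers, hence cancellable on the right; the coalgebra laws of
  -- `a` are inherited from the cofree coalgebra.
  have hSi_ext {X : B} {k l : Cells.mk X ⟶ Cells.mk (S.F.obj E)}
      (h : k ≫ mapCell S.F (cell₁ i) = l ≫ mapCell S.F (cell₁ i)) : k = l := by
    rw [mapCell_cell₁] at h
    exact hSi.cell_hom_ext h
  have hSSi_ext {X : B} {k l : Cells.mk X ⟶ Cells.mk (S.F.obj (S.F.obj E))}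
      (h : k ≫ mapCell S.F (mapCell S.F (cell₁ i)) =
        l ≫ mapCell S.F (mapCell S.F (cell₁ i))) : k = l := by
    rw [mapCell_cell₁, mapCell_cell₁] at h
    exact (hS _ _ _ hSi).cell_hom_ext h
  have counit : cell₁ a ≫ cell₁ (S.extract E) = 𝟙 (Cells.mk E) := hi.cell_hom_ext (by
    rw [Category.assoc, ← S.mapCell_extract, reassoc_of% ha, S.cell_duplicate_extract,
      Category.comp_id, Category.id_comp])
  have coassoc : cell₁ a ≫ cell₁ (S.duplicate E) = cell₁ a ≫ mapCell S.F (cell₁ a) :=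
    hSSi_ext (by
      rw [Category.assoc, ← S.mapCell_duplicate, reassoc_of% ha, S.cell_duplicate_duplicate,
        Category.assoc, ← mapCell_comp, ha, mapCell_comp, reassoc_of% ha])
  refine ⟨ofCell a counit coassoc, i ≫ S.extract W, ?_, fun x k hk => ?_⟩
  · rw [cell₁_comp, Category.assoc, ← S.mapCell_extract, reassoc_of% cond, S.mapCell_extract,
      reassoc_of% S.cell_duplicate_extract, mapCell_comp, Category.assoc, reassoc_of% ha,
      reassoc_of% S.cell_duplicate_mapCell_extract]
  -- `x.str ≫ S k` is the coalgebra morphism into the cofree coalgebra `S W` with underlying `k`;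
  -- the condition on `k` makes it equalize the pair.
  · obtain ⟨l, hl, hl'⟩ := hi.existsUnique_cell (cell₁ x.str ≫ mapCell S.F k) (by
      rw [← mapCell_cell₁, Category.assoc, ← mapCell_comp, hk, mapCell_comp, mapCell_comp,
        ← reassoc_of% x.cell_str_duplicate, cell₁_comp, Category.assoc, reassoc_of% S.mapCell_duplicate,
        mapCell_cell₁])
    obtain ⟨l, rfl⟩ := exists_cellα_eq (y := ofCell a counit coassoc) l (hSi_ext (by
      rw [Category.assoc, ← mapCell_comp, hl, mapCell_comp, ← reassoc_of% x.cell_str_duplicate,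
        ← S.mapCell_duplicate, Category.assoc, ha, reassoc_of% hl]))
    refine ⟨l, ?_, fun m hm => cellα_injective (hl' _ ?_)⟩
    · beta_reduce
      rw [cell₁_comp, reassoc_of% hl, S.mapCell_extract, reassoc_of% x.cell_str_extract]
    -- A coalgebra morphism into a cofree coalgebra is determined by its composite with the counit,
    -- so `m ≫ i` is recovered from `m ≫ e`.
    · rw [← hm, cell₁_comp, mapCell_comp, mapCell_comp, ← Category.assoc, cellα_comm,
        Category.assoc, reassoc_of% ha, S.cell_duplicate_mapCell_extract, Category.comp_id]

end Equalizer

/-! ### Exponentials of coalgebras. -/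

section Exponential

variable {y : CoAlg S} (c : ProductsWith y.carrier) (hS : PreservesTwoProducts S.F)
  {H : B → B} {ev : ∀ Z, c.prod (H Z) ⟶ Z}

/-- Transposing along the universal arrows turns the condition on `y × x ⟶ z` to be a morphism of
coalgebras into an equation between 2-cells `x ⟶ H (S z)`. -/
theorem cell_prodStr_comp_iff (h : ∀ Z, IsTwoUniversal c.twoFunctor (E := H Z) (ev Z))
    {z : CoAlg S} {f : H z.carrier ⟶ H (S.F.obj z.carrier)}
    {g : S.F.obj (H z.carrier) ⟶ H (S.F.obj z.carrier)}
    (hf : c.mapCell (cell₁ f) ≫ cell₁ (ev _) = cell₁ (ev _) ≫ cell₁ z.str)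
    (hg : c.mapCell (cell₁ g) ≫ cell₁ (ev _) =
      cell₁ (strength c hS (H z.carrier)) ≫ mapCell S.F (cell₁ (ev _)))
    (x : CoAlg S) (k : Cells.mk x.carrier ⟶ Cells.mk (H z.carrier)) :
    cell₁ (prodStr c hS x) ≫ mapCell S.F (c.mapCell k ≫ cell₁ (ev _)) =
        (c.mapCell k ≫ cell₁ (ev _)) ≫ cell₁ z.str ↔
      k ≫ cell₁ f = cell₁ x.str ≫ mapCell S.F k ≫ cell₁ g := by
  have h₁ : c.mapCell (k ≫ cell₁ f) ≫ cell₁ (ev _) =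
      (c.mapCell k ≫ cell₁ (ev _)) ≫ cell₁ z.str := by
    rw [c.mapCell_comp, Category.assoc, hf, Category.assoc]
  -- Naturality of the strength moves `S k` past it, which leaves the product structure on `y × x`.
  have h₂ : c.mapCell (cell₁ x.str ≫ mapCell S.F k ≫ cell₁ g) ≫ cell₁ (ev _) =
      cell₁ (prodStr c hS x) ≫ mapCell S.F (c.mapCell k ≫ cell₁ (ev _)) := by
    rw [c.mapCell_comp, c.mapCell_comp, Category.assoc, Category.assoc, hg,
      reassoc_of% mapCell_strength c hS, cell_prodStr, mapCell_comp, Category.assoc]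
  rw [← h₁, ← h₂]
  exact ⟨fun e => ((h _).cell_hom_ext e).symm, fun e => by rw [e]⟩

/-- Exponentials by `y` in the 2-category of strict coalgebras. -/
theorem exists_isTwoUniversal (heq : HasTwoEqualizers B) (hSeq : PreservesTwoEqualizers S.F)
    (h : ∀ Z, IsTwoUniversal c.twoFunctor (E := H Z) (ev Z)) (z : CoAlg S) :
    ∃ (E : CoAlg S) (e : prod c hS E ⟶ z),
      IsTwoUniversal (productsWith c hS).twoFunctor (E := E) e := by
  have exists_transpose {X Z : B} (k : c.prod X ⟶ Z) :
      ∃ l : X ⟶ H Z, c.mapCell (cell₁ l) ≫ cell₁ (ev Z) = cell₁ k := by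
    obtain ⟨l, hl, -⟩ := (h Z).exists_lift k
    refine ⟨l, ?_⟩
    rw [c.mapCell_cell₁, ← cell₁_comp]
    exact congrArg cell₁ hl
  obtain ⟨f, hf⟩ := exists_transpose (ev z.carrier ≫ z.str)
  obtain ⟨g, hg⟩ := exists_transpose (strength c hS (H z.carrier) ≫ S.F.map (ev z.carrier))
  rw [cell₁_comp] at hf hg
  rw [← mapCell_cell₁] at hg
  have key := cell_prodStr_comp_iff c hS h hf hg
  obtain ⟨E, e, he, hE⟩ := exists_equalizer heq hSeq f g
  -- The generic solution `e`, transposed back, is the evaluation; the equation for `e` says that it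
  -- is a coalgebra morphism.
  have comm := (key E _).2 he
  rw [c.mapCell_cell₁, ← cell₁_comp] at comm
  refine ⟨E, homOfCell (x := prod c hS E) _ comm,
    .of_existsUnique_cell fun {x} (β : Cells.mk (prod c hS x) ⟶ Cells.mk z) => ?_⟩
  have factor (l : Cells.mk x ⟶ Cells.mk E) :
      cellα ((productsWith c hS).mapCell l ≫ cell₁ (homOfCell (x := prod c hS E) _ comm)) =
        c.mapCell (cellα l ≫ cell₁ e) ≫ cell₁ (ev _) := by
    rw [cellα_comp, cellα_productsWith_mapCell, cellα_cell₁, homOfCell, cell₁_comp,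
      c.mapCell_comp, c.mapCell_cell₁, Category.assoc]
  obtain ⟨k, hk, hk'⟩ := (h z.carrier).existsUnique_cell (cellα β)
  replace hk : c.mapCell k ≫ cell₁ (ev z.carrier) = cellα β := hk
  obtain ⟨l, hl, hl'⟩ := hE x k ((key x k).1 (by
    rw [hk]
    exact cellα_comm β))
  refine ⟨l, cellα_injective ((factor l).trans (by rw [hl, hk]; rfl)),
    fun m hm => hl' _ (hk' _ ?_)⟩
  exact (factor m).symm.trans (congrArg cellα hm)

end Exponential

end CoAlg

end TwoComonad

end TwoCat

end

theorem mainTheorem4 {B : Type u} [Bicategory.{w, v} B] [Bicategory.Strict B]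
    (S : TwoCat.TwoComonad B)
    (hprod : TwoCat.HasTwoProducts B) (heq : TwoCat.HasTwoEqualizers B)
    (hSprod : TwoCat.PreservesTwoProducts S.F) (hSeq : TwoCat.PreservesTwoEqualizers S.F)
    (y : S.CoAlg) (hy : TwoCat.Exponentiable (S.forget.obj y)) :
    TwoCat.Exponentiable y := by
  obtain ⟨c, H, ⟨adj⟩⟩ : TwoCat.Exponentiable y.carrier := hy
  -- The coalgebras `E z` are the values of the right 2-adjoint, with universal arrows `e z`.
  choose E e he using TwoCat.TwoComonad.CoAlg.exists_isTwoUniversal c hSprod heq hSeq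
    adj.isTwoUniversal
  exact ⟨_, TwoCat.HasRightTwoAdjoint.of_isTwoUniversal he⟩
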